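/- Let $n\ge 1$, let $\mathbb{H}^n$ be the $n$-dimensional hyperbolic space (constant curvature $-1$) with its Riemannian volume $dx$, let $a\in\mathbb{H}^n$, let $|x|_a$ denote the hyperbolic distance from $x$ to $a$, and let $\mathbb{B}(a,r)=\{x\in\mathbb{H}^n : |x|_a\le r\}$. Let $\alpha,\beta\in\mathbb{R}$ and $1\le q<\infty$. Consider the statement that there is a finite constant $C$ such that $$\left(\int_{\mathbb{H}^n}\left(\int_{\mathbb{B}(a,|x|_a)}|f(y)|\,dy\right)^q(\sinh|x|_a)^{-\beta q}\,dx\right)^{1/q}\le C\int_{\mathbb{H}^n}|f(x)|\,(\sinh|x|_a)^{\alpha}\,dx$$ for all measurable functions $f:\mathbb{H}^n\to\mathbb{C}$ (all integrals being taken in $[0,\infty]$). (a) If $n-\beta q\ge 0$, this statement holds if and only if $\alpha\le 0$, $\alpha+\beta\ge\frac{n-1}{q}$, and $(\alpha,\beta)$ is neither of the two points $\left(0,\frac{n-1}{q}\right)$, $\left(0,\frac{n}{q}\right)$. (b) If $n-\beta q<0$, this statement holds if and only if $\alpha\le 0$ and $\frac{n-1}{q}\le\alpha+\beta\le\frac{n}{q}$.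 -/

import Mathlib

open MeasureTheory
open scoped ENNReal NNReal

noncomputable section

/-- The Minkowski form `⟨x, y⟩ - s t` on `ℝⁿ × ℝ`, of signature `(n, 1)`. -/
def minkowski {n : ℕ} (p p' : EuclideanSpace ℝ (Fin n) × ℝ) : ℝ :=
  inner ℝ p.1 p'.1 - p.2 * p'.2

/-- Hyperbolic space `ℍⁿ` (hyperboloid model): the upper sheet of the hyperboloid
`⟨p, p⟩ = -1` in Minkowski space `ℝⁿ × ℝ`. -/
def HyperbolicSpace (n : ℕ) : Type :=
  {p : EuclideanSpace ℝ (Fin n) × ℝ // minkowski p p = -1 ∧ 0 < p.2}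

namespace HyperbolicSpace

variable {n : ℕ}

/-- The Borel structure induced from the ambient space. -/
instance : MeasurableSpace (HyperbolicSpace n) :=
  inferInstanceAs (MeasurableSpace
    {p : EuclideanSpace ℝ (Fin n) × ℝ // minkowski p p = -1 ∧ 0 < p.2})

/-- The hyperbolic distance: `cosh d(x, y) = -⟨x, y⟩` for the Minkowski form. -/
def hdist (x y : HyperbolicSpace n) : ℝ :=
  Real.arcosh (-minkowski x.1 y.1)

/-- The closed ball with centre `a` and radius `r` for the hyperbolic distance. -/
def hball (a : HyperbolicSpace n) (r : ℝ) : Set (HyperbolicSpace n) :=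
  {x | hdist x a ≤ r}

/-- The hyperboloid as the graph of `x ↦ √(1 + |x|²)`, with values in the ambient space. -/
def graphMap (x : EuclideanSpace ℝ (Fin n)) : EuclideanSpace ℝ (Fin n) × ℝ :=
  (x, √(1 + ‖x‖ ^ 2))

theorem graphMap_mem (x : EuclideanSpace ℝ (Fin n)) :
    minkowski (graphMap x) (graphMap x) = -1 ∧ 0 < (graphMap x).2 := by
  have h : 0 < 1 + ‖x‖ ^ 2 := by positivity
  refine ⟨?_, Real.sqrt_pos.2 h⟩
  simp only [minkowski, graphMap, real_inner_self_eq_norm_sq, Real.mul_self_sqrt h.le]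
  ring

/-- The global parametrization of `ℍⁿ` by `ℝⁿ` (inverse of the projection `(x, t) ↦ x`). -/
def param (x : EuclideanSpace ℝ (Fin n)) : HyperbolicSpace n :=
  ⟨graphMap x, graphMap_mem x⟩

theorem measurable_param : Measurable (param : EuclideanSpace ℝ (Fin n) → HyperbolicSpace n) := by
  refine Measurable.subtype_mk ?_
  unfold graphMap
  fun_prop

/-- The Riemannian metric of `ℍⁿ` in the coordinates `param`: the entries are
`⟨∂ᵢ graphMap, ∂ⱼ graphMap⟩` for the Minkowski form, i.e. the metric that the Minkowski form
induces on the hyperboloid. -/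
def metricMatrix (x : EuclideanSpace ℝ (Fin n)) : Matrix (Fin n) (Fin n) ℝ :=
  Matrix.of fun i j =>
    minkowski (fderiv ℝ graphMap x (EuclideanSpace.single i 1))
      (fderiv ℝ graphMap x (EuclideanSpace.single j 1))

/-- The Riemannian volume of `ℍⁿ`: in the coordinates `param` it is `√(det g) dx`. -/
def hvol : Measure (HyperbolicSpace n) :=
  (volume.withDensity fun x : EuclideanSpace ℝ (Fin n) =>
    ENNReal.ofReal √(metricMatrix x).det).map param

/-- The two-weight `L¹` Hardy inequality on `ℍⁿ` with centre `a`, exponent `q` and weights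
`u`, `v`: there is a finite constant `C` such that for all measurable `f : ℍⁿ → ℂ`,
`(∫ (∫_{B(a,|x|_a)} |f(y)| dy)^q u(x) dx)^{1/q} ≤ C ∫ |f(x)| v(x) dx`.
All integrals are taken in `[0, ∞]`. -/
def L1HardyInequality (a : HyperbolicSpace n) (q : ℝ) (u v : HyperbolicSpace n → ℝ) : Prop :=
  ∃ C : ℝ≥0, ∀ f : HyperbolicSpace n → ℂ, Measurable f →
    (∫⁻ x, (∫⁻ y in hball a (hdist x a), ‖f y‖ₑ ∂hvol) ^ q * ENNReal.ofReal (u x) ∂hvol) ^ (1 / q)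
      ≤ C * ∫⁻ x, ‖f x‖ₑ * ENNReal.ofReal (v x) ∂hvol

end HyperbolicSpace

end

/-! An operator from a weighted `L¹` space is governed by its values on point masses. A unit mass at
`y` contributes `1` to the inner integral exactly when `|x|_a ≥ |y|_a`, so the inequality holds if
and only if `∫_{|x|_a ≥ |y|_a} (sinh |x|_a)^(-βq) dx ≤ C (sinh |y|_a)^(αq)` for all `y ≠ a`.
Sufficiency is Minkowski's integral inequality (`lintegral_sublevel_rpow_le`); for necessity,
thin-mass tests are replaced by indicators of annuli, on which the weight is constant up to a
factor.

In the variable `r = sinh |x|_a` the volume is a multiple of `r^(n-1) (1+r²)^(-1/2) dr`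
(`lintegral_hvol_sinh_hdist`). The condition becomes `hypTail k s ≤ C s^γ` for all `s > 0`, with `k
= n - βq` and `γ = αq`.

The tail is finite only for `k < 1`, and then is of order `s^(k-1)` at infinity; at zero it is of
order `s^k`, `log (1/s)` or `1` according as `k < 0`, `k = 0` or `k > 0`. Comparison with `s^γ`
gives `k - 1 ≤ γ ≤ 0`, also `γ ≤ k` when `k < 0`, and for `γ = 0` excludes `k = 1` (infinite tail)
and `k = 0` (logarithm): `hypTail_le_rpow_iff`.

Polar coordinates at the base point are immediate in the graph chart. They move to any centre
because the volume comes from Lebesgue measure on the future cone, which Lorentz maps preserve. -/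

/-- The tail integral `∫_s^∞ r^(k-1) (1+r²)^(-1/2) dr`. -/
noncomputable def hypTail (k s : ℝ) : ℝ≥0∞ :=
  ∫⁻ r in Set.Ioi s, ENNReal.ofReal (r ^ (k - 1) / √(1 + r ^ 2))

/-! ### Asymptotics of the tail integrals -/

section Tail
open Set

theorem hypTail_anti (k : ℝ) {s t : ℝ} (h : s ≤ t) : hypTail k t ≤ hypTail k s :=
  lintegral_mono_set (Ioi_subset_Ioi h)

theorem exponent_nonpos_of_rpow_bounded {e C : ℝ} (h : ∀ s : ℝ, 1 ≤ s → s ^ e ≤ C) : e ≤ 0 := by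
  by_contra! he
  have := tendsto_rpow_atTop he
  obtain ⟨s, h1, h2⟩ := ((this.eventually_gt_atTop C).and (Filter.eventually_ge_atTop 1)).exists
  exact absurd (h s h2) (not_le.2 h1)

theorem exponent_nonneg_of_rpow_bounded {e C : ℝ} (h : ∀ s : ℝ, 0 < s → s ≤ 1 → s ^ e ≤ C) :
    0 ≤ e := by
  have : -e ≤ 0 := exponent_nonpos_of_rpow_bounded (C := C) fun s hs => by
    have hs0 : 0 < s := by linarith
    rw [Real.rpow_neg hs0.le, ← Real.inv_rpow hs0.le]
    exact h _ (inv_pos.2 hs0) (inv_le_one_of_one_le₀ hs)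
  linarith

theorem lintegral_Ioi_rpow_sub_one {γ s : ℝ} (hγ : γ < 0) (hs : 0 < s) :
    ∫⁻ r in Ioi s, ENNReal.ofReal (r ^ (γ - 1)) = ENNReal.ofReal (s ^ γ / (-γ)) := by
  rw [← ofReal_integral_eq_lintegral_ofReal
    (integrableOn_Ioi_rpow_of_lt (by linarith) hs)]
  · rw [integral_Ioi_rpow_of_lt (by linarith) hs, sub_add_cancel, neg_div, div_neg]
  · filter_upwards [ae_restrict_mem measurableSet_Ioi] with r hr
    exact Real.rpow_nonneg (hs.le.trans (le_of_lt hr)) _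

theorem one_le_sqrt_one_add_sq (r : ℝ) : 1 ≤ √(1 + r ^ 2) := by
  rw [Real.one_le_sqrt]; nlinarith [sq_nonneg r]

theorem le_sqrt_one_add_sq (r : ℝ) : r ≤ √(1 + r ^ 2) :=
  Real.le_sqrt_of_sq_le (by linarith)

/-- The left side is at most both `r^(k-1)` and `r^(k-2)`; the exponent `γ - 1` lies between these
two, so a single power dominates on both sides of `r = 1`. -/
theorem rpow_div_sqrt_le_rpow {k γ r : ℝ} (hr : 0 < r) (h1 : k - 1 ≤ γ) (h2 : γ ≤ k) :
    r ^ (k - 1) / √(1 + r ^ 2) ≤ r ^ (γ - 1) := by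
  have hk : 0 < r ^ (k - 1) := Real.rpow_pos_of_pos hr _
  rcases le_total r 1 with h | h
  · exact (div_le_self hk.le (one_le_sqrt_one_add_sq r)).trans
      (Real.rpow_le_rpow_of_exponent_ge hr h (by linarith))
  · calc r ^ (k - 1) / √(1 + r ^ 2) ≤ r ^ (k - 1) / r := by
          gcongr; exact le_sqrt_one_add_sq r
      _ = r ^ (k - 1 - 1) := (Real.rpow_sub_one hr.ne' _).symm
      _ ≤ r ^ (γ - 1) := Real.rpow_le_rpow_of_exponent_le h (by linarith)

theorem hypTail_le_of_neg {k γ s : ℝ} (hs : 0 < s) (hγ : γ < 0) (h1 : k - 1 ≤ γ) (h2 : γ ≤ k) :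
    hypTail k s ≤ ENNReal.ofReal (-γ)⁻¹ * ENNReal.ofReal (s ^ γ) := by
  have hp : 0 ≤ (-γ)⁻¹ := inv_nonneg.2 (by linarith)
  rw [← ENNReal.ofReal_mul hp, inv_mul_eq_div, ← lintegral_Ioi_rpow_sub_one hγ hs]
  refine setLIntegral_mono' measurableSet_Ioi fun r hr => ?_
  exact ENNReal.ofReal_le_ofReal (rpow_div_sqrt_le_rpow (hs.trans hr) h1 h2)

theorem hypTail_zero_lt_top {k : ℝ} (h0 : 0 < k) (h1 : k < 1) : hypTail k 0 < ∞ := by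
  have key : ∀ {t : Set ℝ} {e : ℝ}, MeasurableSet t → t ⊆ Ioi 0 →
      IntegrableOn (fun r : ℝ => r ^ e) t →
      (∀ r ∈ t, r ^ (k - 1) / √(1 + r ^ 2) ≤ r ^ e) →
      ∫⁻ r in t, ENNReal.ofReal (r ^ (k - 1) / √(1 + r ^ 2)) < ∞ := by
    intro t e ht hsub hint hle
    refine (setLIntegral_mono' ht fun r hr => ENNReal.ofReal_le_ofReal (hle r hr)).trans_lt ?_
    exact hint.lintegral_lt_top
  have hsplit : Ioi (0 : ℝ) = Ioo 0 1 ∪ Ici 1 := (Ioo_union_Ici_eq_Ioi zero_lt_one).symm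
  rw [hypTail, hsplit]
  refine (lintegral_union_le _ _ _).trans_lt (ENNReal.add_lt_top.2 ⟨?_, ?_⟩)
  · refine key (e := k - 1) measurableSet_Ioo (fun r hr => hr.1)
      ((intervalIntegral.integrableOn_Ioo_rpow_iff zero_lt_one).2 (by linarith)) fun r hr => ?_
    exact div_le_self (Real.rpow_nonneg hr.1.le _) (one_le_sqrt_one_add_sq r)
  · refine key (e := k - 1 - 1) measurableSet_Ici
      (fun r (hr : 1 ≤ r) => zero_lt_one.trans_le hr) ?_
      fun r (hr : 1 ≤ r) => rpow_div_sqrt_le_rpow (zero_lt_one.trans_le hr) (by linarith) (by linarith)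
    rw [integrableOn_Ici_iff_integrableOn_Ioi]
    exact integrableOn_Ioi_rpow_of_lt (by linarith) zero_lt_one

/-- Only the range `(s, 2s)` is kept; the minimum covers both signs of `k - 1`. The bound has order
`s^k` at zero and `s^(k-1)` at infinity. -/
theorem le_hypTail {k s : ℝ} (hs : 0 < s) :
    ENNReal.ofReal (min 1 (2 ^ (k - 1)) * s ^ k / √(1 + (2 * s) ^ 2)) ≤ hypTail k s := by
  have hm : 0 ≤ min (1 : ℝ) (2 ^ (k - 1)) := by positivity
  have hsk : s ^ k = s ^ (k - 1) * s := by
    rw [Real.rpow_sub_one hs.ne', div_mul_cancel₀ _ hs.ne']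
  calc _ = ENNReal.ofReal (min 1 (2 ^ (k - 1)) * s ^ (k - 1) / √(1 + (2 * s) ^ 2))
          * ENNReal.ofReal s := by
        rw [← ENNReal.ofReal_mul (by positivity), hsk]; congr 1; ring
    _ = ∫⁻ r in Ioo s (2 * s),
          ENNReal.ofReal (min 1 (2 ^ (k - 1)) * s ^ (k - 1) / √(1 + (2 * s) ^ 2)) := by
        rw [setLIntegral_const, Real.volume_Ioo]; congr 2; ring
    _ ≤ ∫⁻ r in Ioo s (2 * s), ENNReal.ofReal (r ^ (k - 1) / √(1 + r ^ 2)) := by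
        refine setLIntegral_mono' measurableSet_Ioo fun r hr => ENNReal.ofReal_le_ofReal ?_
        have hr0 : 0 < r := hs.trans hr.1
        have h1 : min 1 (2 ^ (k - 1)) * s ^ (k - 1) ≤ r ^ (k - 1) := by
          rcases le_total 0 (k - 1) with h | h
          · calc _ ≤ 1 * s ^ (k - 1) := by gcongr; exact min_le_left _ _
              _ ≤ r ^ (k - 1) := by
                rw [one_mul]; exact Real.rpow_le_rpow hs.le hr.1.le h
          · calc _ ≤ 2 ^ (k - 1) * s ^ (k - 1) := by gcongr; exact min_le_right _ _
              _ = (2 * s) ^ (k - 1) := (Real.mul_rpow zero_le_two hs.le).symm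
              _ ≤ r ^ (k - 1) := Real.rpow_le_rpow_of_nonpos hr0 hr.2.le h
        have h2 : r ≤ 2 * s := hr.2.le
        gcongr
    _ ≤ hypTail k s := lintegral_mono_set Ioo_subset_Ioi_self

theorem lt_one_of_hypTail_lt_top {k : ℝ} (h : hypTail k 1 < ∞) : k < 1 := by
  have hint : IntegrableOn (fun r : ℝ => r ^ (k - 1 - 1)) (Ioi 1) := by
    have hm : Measurable fun r : ℝ => r ^ (k - 1 - 1) := by fun_prop
    refine ⟨hm.aestronglyMeasurable, ?_⟩
    have hle : ∫⁻ r in Ioi (1 : ℝ), ‖r ^ (k - 1 - 1)‖ₑ ≤ ENNReal.ofReal 2 * hypTail k 1 := by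
      rw [hypTail, ← lintegral_const_mul' _ _ ENNReal.ofReal_ne_top]
      refine setLIntegral_mono' measurableSet_Ioi fun r hr => ?_
      have hr1 : 1 < r := hr
      have hr0 : 0 < r := zero_lt_one.trans hr
      rw [Real.enorm_of_nonneg (Real.rpow_nonneg hr0.le _), ← ENNReal.ofReal_mul zero_le_two]
      refine ENNReal.ofReal_le_ofReal ?_
      have hsq : √(1 + r ^ 2) ≤ 2 * r := by
        rw [Real.sqrt_le_left (by linarith)]; nlinarith
      rw [Real.rpow_sub_one hr0.ne' (k - 1), ← mul_div_assoc, div_le_div_iff₀ hr0 (by positivity)]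
      calc r ^ (k - 1) * √(1 + r ^ 2) ≤ r ^ (k - 1) * (2 * r) := by gcongr
        _ = 2 * r ^ (k - 1) * r := by ring
    exact hle.trans_lt (ENNReal.mul_lt_top ENNReal.ofReal_lt_top h)
  rw [integrableOn_Ioi_rpow_iff zero_lt_one] at hint
  linarith

/-- Bounded tails would make `1/r` integrable on `(0, 1)`, by monotone convergence along `s =
1/(n+1)`. -/
theorem hypTail_zero_exponent_unbounded (C : ℝ≥0) : ∃ s : ℝ, 0 < s ∧ C < hypTail 0 s := by
  by_contra! hC
  have hlt : hypTail 0 0 ≤ C := by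
    have hU : Ioi (0 : ℝ) = ⋃ n : ℕ, Ioi (1 / ((n : ℝ) + 1)) := by
      ext r
      simp only [mem_Ioi, mem_iUnion]
      refine ⟨fun h => exists_nat_one_div_lt h, fun ⟨n, h⟩ => lt_trans (by positivity) h⟩
    have hmono : Monotone fun n : ℕ => Ioi (1 / ((n : ℝ) + 1)) := fun m n hmn =>
      Ioi_subset_Ioi (by gcongr)
    rw [hypTail, hU, setLIntegral_iUnion_of_directed _ hmono.directed_le]
    exact iSup_le fun n => hC _ (by positivity)
  have hint : IntegrableOn (fun r : ℝ => r ^ (-1 : ℝ)) (Ioo 0 1) := by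
    have hm : Measurable fun r : ℝ => r ^ (-1 : ℝ) := by fun_prop
    refine ⟨hm.aestronglyMeasurable, ?_⟩
    have hle : ∫⁻ r in Ioo (0 : ℝ) 1, ‖r ^ (-1 : ℝ)‖ₑ ≤ ENNReal.ofReal 2 * hypTail 0 0 := by
      rw [hypTail, ← lintegral_const_mul' _ _ ENNReal.ofReal_ne_top]
      refine le_trans ?_ (lintegral_mono_set (show Ioo (0 : ℝ) 1 ⊆ Ioi 0 from Ioo_subset_Ioi_self))
      refine setLIntegral_mono' measurableSet_Ioo fun r hr => ?_
      have hr0 : 0 < r := hr.1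
      rw [Real.enorm_of_nonneg (Real.rpow_nonneg hr0.le _), ← ENNReal.ofReal_mul zero_le_two]
      refine ENNReal.ofReal_le_ofReal ?_
      have hsq : √(1 + r ^ 2) ≤ 2 := by
        rw [Real.sqrt_le_left (by linarith)]; nlinarith [hr.2]
      have hp : 0 < r ^ (-1 : ℝ) := Real.rpow_pos_of_pos hr0 _
      rw [zero_sub, ← mul_div_assoc, le_div_iff₀ (by positivity), mul_comm]
      gcongr
    exact hle.trans_lt (ENNReal.mul_lt_top ENNReal.ofReal_lt_top (hlt.trans_lt ENNReal.coe_lt_top))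
  rw [intervalIntegral.integrableOn_Ioo_rpow_iff zero_lt_one] at hint
  exact lt_irrefl _ hint

/-- Power bounds for the tail integrals. -/
theorem hypTail_le_rpow_iff (k γ : ℝ) :
    (∃ C : ℝ≥0, ∀ s : ℝ, 0 < s → hypTail k s ≤ C * ENNReal.ofReal (s ^ γ)) ↔
      γ ≤ 0 ∧ k - 1 ≤ γ ∧ (k < 0 → γ ≤ k) ∧ (γ = 0 → k ≠ 1 ∧ k ≠ 0) := by
  constructor
  · rintro ⟨C, hC⟩
    set m : ℝ := min 1 (2 ^ (k - 1)) with hm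
    have hm0 : 0 < m := by positivity
    have hlow : ∀ s : ℝ, 0 < s → m * s ^ k / √(1 + (2 * s) ^ 2) ≤ C * s ^ γ := fun s hs => by
      have := (le_hypTail hs).trans (hC s hs)
      rw [← ENNReal.ofReal_coe_nnreal, ← ENNReal.ofReal_mul C.coe_nonneg] at this
      exact (ENNReal.ofReal_le_ofReal_iff (by positivity)).1 this
    have hk1 : k < 1 := lt_one_of_hypTail_lt_top <|
      (hC 1 one_pos).trans_lt (ENNReal.mul_lt_top ENNReal.coe_lt_top ENNReal.ofReal_lt_top)
    refine ⟨?_, ?_, fun _ => ?_, fun hγ => ⟨hk1.ne, ?_⟩⟩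
    -- For `s ≤ 1` the tail is at least its value at `1`, which is at least `d > 0`; so `s^γ` cannot
    -- tend to zero with `s`.
    · set d : ℝ := m * 1 ^ k / √(1 + (2 * 1) ^ 2)
      have hd : 0 < d := by positivity
      have : 0 ≤ -γ := exponent_nonneg_of_rpow_bounded (C := C / d) fun s hs hs1 => by
        have h := ((le_hypTail (k := k) one_pos).trans (hypTail_anti k hs1)).trans (hC s hs)
        rw [← ENNReal.ofReal_coe_nnreal, ← ENNReal.ofReal_mul C.coe_nonneg] at h
        have h := (ENNReal.ofReal_le_ofReal_iff (by positivity)).1 h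
        have hp := Real.rpow_pos_of_pos hs γ
        rw [Real.rpow_neg hs.le, le_div_iff₀ hd, inv_mul_le_iff₀ hp, mul_comm]
        exact h
      linarith
    -- Large `s`: here the square root is at most `3s`, which costs one power.
    · have : k - 1 - γ ≤ 0 := exponent_nonpos_of_rpow_bounded (C := 3 * C / m) fun s hs => by
        have hs0 : 0 < s := by linarith
        have hp := Real.rpow_pos_of_pos hs0 γ
        have hpk := Real.rpow_pos_of_pos hs0 k
        have hsq : √(1 + (2 * s) ^ 2) ≤ 3 * s := by
          rw [Real.sqrt_le_left (by linarith)]; nlinarith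
        have h := hlow s hs0
        rw [div_le_iff₀ (by positivity)] at h
        rw [Real.rpow_sub hs0, Real.rpow_sub_one hs0.ne', div_div, div_le_div_iff₀ (by positivity)
          hm0]
        calc s ^ k * m = m * s ^ k := mul_comm _ _
          _ ≤ C * s ^ γ * √(1 + (2 * s) ^ 2) := h
          _ ≤ C * s ^ γ * (3 * s) := by gcongr
          _ = _ := by ring
      linarith
    -- Small `s`: here the square root is at most `3`.
    · have : 0 ≤ k - γ := exponent_nonneg_of_rpow_bounded (C := 3 * C / m) fun s hs hs1 => by
        have hp := Real.rpow_pos_of_pos hs γ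
        have hsq : √(1 + (2 * s) ^ 2) ≤ 3 := by
          rw [Real.sqrt_le_left (by linarith)]; nlinarith
        have h := hlow s hs
        rw [div_le_iff₀ (by positivity)] at h
        rw [Real.rpow_sub hs, div_le_div_iff₀ (by positivity) hm0]
        calc s ^ k * m = m * s ^ k := mul_comm _ _
          _ ≤ C * s ^ γ * √(1 + (2 * s) ^ 2) := h
          _ ≤ C * s ^ γ * 3 := by gcongr
          _ = _ := by ring
      linarith
    · rintro rfl
      obtain ⟨s, hs, hlt⟩ := hypTail_zero_exponent_unbounded C
      have := hC s hs
      rw [hγ, Real.rpow_zero, ENNReal.ofReal_one, mul_one] at this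
      exact absurd this (not_le.2 hlt)
  · rintro ⟨h0, h1, h2, h3⟩
    rcases h0.lt_or_eq with hγ | rfl
    · have hk : γ ≤ k := by
        by_cases hk : k < 0
        · exact h2 hk
        · linarith
      exact ⟨(-γ)⁻¹.toNNReal, fun s hs => hypTail_le_of_neg hs hγ h1 hk⟩
    -- When `γ = 0` the constraints leave `0 < k < 1`, where the whole integral from zero converges.
    · obtain ⟨h4, h5⟩ := h3 rfl
      have hk0 : 0 < k := lt_of_le_of_ne (not_lt.1 fun h => absurd (h2 h) (not_le.2 h)) h5.symm
      have hk1 : k < 1 := lt_of_le_of_ne (by linarith) h4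
      have hfin := hypTail_zero_lt_top hk0 hk1
      refine ⟨(hypTail k 0).toNNReal, fun s hs => ?_⟩
      rw [Real.rpow_zero, ENNReal.ofReal_one, mul_one, ENNReal.coe_toNNReal hfin.ne]
      exact hypTail_anti k hs.le

end Tail

/-! ### Hardy operators from `L¹` to `L^q` -/

section Hardy

variable {X : Type*} [MeasurableSpace X]

/-- Hölder against the constant `1`: Jensen's inequality without normalizing the measure. -/
theorem lintegral_rpow_le_measure_univ_mul {μ : Measure X} {g : X → ℝ≥0∞} (hg : AEMeasurable g μ)
    {q : ℝ} (hq : 1 ≤ q) :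
    (∫⁻ x, g x ∂μ) ^ q ≤ μ Set.univ ^ (q - 1) * ∫⁻ x, g x ^ q ∂μ := by
  rcases hq.eq_or_lt with rfl | hq
  · simp
  have hq0 : 0 < q := by linarith
  have hc := Real.HolderConjugate.conjExponent hq
  have h := ENNReal.lintegral_mul_le_Lp_mul_Lq μ hc hg (aemeasurable_const (b := 1))
  simp only [Pi.mul_apply, mul_one, ENNReal.one_rpow, lintegral_const, one_mul] at h
  calc (∫⁻ x, g x ∂μ) ^ q
      ≤ ((∫⁻ x, g x ^ q ∂μ) ^ (1 / q) * μ Set.univ ^ (1 / q.conjExponent)) ^ q := by gcongr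
    _ = _ := by
      rw [ENNReal.mul_rpow_of_nonneg _ _ hq0.le, ← ENNReal.rpow_mul, ← ENNReal.rpow_mul,
        one_div_mul_cancel hq0.ne', ENNReal.rpow_one, mul_comm]
      congr 2
      rw [Real.conjExponent]
      field_simp

/-- Weighted `L¹ → L^q` bound for integrals over sublevel sets: the case of Minkowski's integral
inequality that bounds a Hardy operator. -/
theorem lintegral_sublevel_rpow_le {μ : Measure X} [SFinite μ] {ρ : X → ℝ} (hρ : Measurable ρ)
    {U W F : X → ℝ≥0∞} (hU : Measurable U) (hW : Measurable W) (hF : Measurable F)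
    {q : ℝ} (hq : 1 ≤ q) (hW0 : ∀ᵐ y ∂μ, W y ≠ 0) (hWtop : ∀ᵐ y ∂μ, W y ≠ ∞)
    (h : ∀ᵐ y ∂μ, ∫⁻ x in {x | ρ y ≤ ρ x}, U x ∂μ ≤ W y ^ q) :
    ∫⁻ x, (∫⁻ y in {y | ρ y ≤ ρ x}, F y ∂μ) ^ q * U x ∂μ ≤ (∫⁻ y, F y * W y ∂μ) ^ q := by
  have hq0 : 0 < q := by linarith
  set m := ∫⁻ y, F y * W y ∂μ with hm
  -- Relative to `M`, of total mass `m`, the inner integral of `F` is that of `W⁻¹`, so Jensen's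
  -- inequality applies with the mass `m` as constant.
  set M := μ.withDensity (fun y => F y * W y) with hM
  have hMu : M Set.univ = m := by rw [hM, withDensity_apply _ MeasurableSet.univ]; simp [hm]
  by_cases hmtop : m = ∞
  · rw [hmtop, ENNReal.top_rpow_of_pos hq0]; exact le_top
  have hac : M ≪ μ := withDensity_absolutelyContinuous _ _
  have hS : ∀ x, MeasurableSet {y | ρ y ≤ ρ x} := fun x => measurableSet_le hρ measurable_const
  have hS' : ∀ x, MeasurableSet {y | ρ x ≤ ρ y} := fun x => measurableSet_le measurable_const hρ
  have hFM : ∀ x, ∫⁻ y in {y | ρ y ≤ ρ x}, F y ∂μ = ∫⁻ y in {y | ρ y ≤ ρ x}, (W y)⁻¹ ∂M := fun x => by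
    rw [hM, setLIntegral_withDensity_eq_setLIntegral_mul μ (f := fun y => F y * W y)
      (g := fun y => (W y)⁻¹) (hF.mul hW) hW.inv (hS x)]
    refine lintegral_congr_ae (ae_restrict_of_ae ?_)
    filter_upwards [hW0, hWtop] with y h0 ht
    simp only [Pi.mul_apply]
    rw [mul_assoc, ENNReal.mul_inv_cancel h0 ht, mul_one]
  have hjensen : ∀ x, (∫⁻ y in {y | ρ y ≤ ρ x}, F y ∂μ) ^ q ≤
      m ^ (q - 1) * ∫⁻ y in {y | ρ y ≤ ρ x}, (W y)⁻¹ ^ q ∂M := fun x => by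
    rw [hFM x]
    refine (lintegral_rpow_le_measure_univ_mul (g := fun y => (W y)⁻¹) hW.inv.aemeasurable
      hq).trans ?_
    rw [Measure.restrict_apply_univ, ← hMu]
    have hq1 : 0 ≤ q - 1 := by linarith
    gcongr
    exact Set.subset_univ _
  have hmeas : MeasurableSet {p : X × X | ρ p.2 ≤ ρ p.1} :=
    measurableSet_le (hρ.comp measurable_snd) (hρ.comp measurable_fst)
  set K : X → X → ℝ≥0∞ := fun x y =>
    Set.indicator {p : X × X | ρ p.2 ≤ ρ p.1} (fun p => (W p.2)⁻¹ ^ q * U p.1) (x, y) with hK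
  have hKm : Measurable (Function.uncurry K) := by
    have : Measurable fun p : X × X => (W p.2)⁻¹ ^ q * U p.1 := by fun_prop
    exact this.indicator hmeas
  calc ∫⁻ x, (∫⁻ y in {y | ρ y ≤ ρ x}, F y ∂μ) ^ q * U x ∂μ
      ≤ ∫⁻ x, m ^ (q - 1) * ∫⁻ y, K x y ∂M ∂μ := by
        refine lintegral_mono fun x => ?_
        calc _ ≤ m ^ (q - 1) * (∫⁻ y in {y | ρ y ≤ ρ x}, (W y)⁻¹ ^ q ∂M) * U x := by
              gcongr; exact hjensen x
          _ = m ^ (q - 1) * ∫⁻ y in {y | ρ y ≤ ρ x}, (W y)⁻¹ ^ q * U x ∂M := by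
              rw [mul_assoc, lintegral_mul_const _ (by fun_prop)]
          _ = m ^ (q - 1) * ∫⁻ y, K x y ∂M := by
              rw [← lintegral_indicator (hS x)]; rfl
    _ = m ^ (q - 1) * ∫⁻ x, ∫⁻ y, K x y ∂M ∂μ :=
        lintegral_const_mul _ hKm.lintegral_prod_right'
    _ = m ^ (q - 1) * ∫⁻ y, ∫⁻ x, K x y ∂μ ∂M := by
        rw [lintegral_lintegral_swap hKm.aemeasurable]
    -- After Tonelli, hypothesis `h` bounds the tail of `U` by `W y ^ q`, which cancels the factor
    -- `W⁻¹ ^ q`.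
    _ ≤ m ^ (q - 1) * ∫⁻ _, 1 ∂M := by
        gcongr 1
        refine lintegral_mono_ae ?_
        filter_upwards [hac.ae_le hW0, hac.ae_le hWtop, hac.ae_le h] with y h0 ht hy
        calc ∫⁻ x, K x y ∂μ = ∫⁻ x in {x | ρ y ≤ ρ x}, (W y)⁻¹ ^ q * U x ∂μ := by
              rw [← lintegral_indicator (hS' y)]; rfl
          _ = (W y)⁻¹ ^ q * ∫⁻ x in {x | ρ y ≤ ρ x}, U x ∂μ := lintegral_const_mul _ hU
          _ ≤ (W y)⁻¹ ^ q * W y ^ q := by gcongr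
          _ = 1 := by
              rw [← ENNReal.mul_rpow_of_nonneg _ _ hq0.le, ENNReal.inv_mul_cancel h0 ht,
                ENNReal.one_rpow]
    _ = m ^ q := by
        rw [lintegral_one, hMu]
        nth_rewrite 2 [← ENNReal.rpow_one m]
        rw [← ENNReal.rpow_add_of_nonneg _ _ (by linarith) zero_le_one, sub_add_cancel]

end Hardy

/-! ### Polar coordinates in a normed space -/

section Radial
open Set

theorem lintegral_comp_norm_addHaar {E : Type*} [NormedAddCommGroup E] [NormedSpace ℝ E]
    [MeasurableSpace E] [BorelSpace E] [FiniteDimensional ℝ E] [Nontrivial E]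
    (μ : Measure E) [μ.IsAddHaarMeasure] {g : ℝ → ℝ≥0∞} (hg : Measurable g) :
    ∫⁻ x, g ‖x‖ ∂μ = μ.toSphere univ *
      ∫⁻ r in Ioi (0 : ℝ), ENNReal.ofReal (r ^ (Module.finrank ℝ E - 1)) * g r := by
  have hms : MeasurableSet ({0}ᶜ : Set E) := (measurableSet_singleton _).compl
  have hg' : Measurable fun r : Ioi (0 : ℝ) => g r := hg.comp measurable_subtype_coe
  calc ∫⁻ x, g ‖x‖ ∂μ = ∫⁻ x : ({0}ᶜ : Set E), g ‖x.1‖ ∂(μ.comap (↑)) := by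
        rw [lintegral_subtype_comap hms fun x => g ‖x‖, restrict_compl_singleton]
    _ = ∫⁻ x, g x.2 ∂μ.toSphere.prod (.volumeIoiPow (Module.finrank ℝ E - 1)) := by
        rw [← μ.measurePreserving_homeomorphUnitSphereProd.lintegral_comp
          (f := fun x : Metric.sphere (0 : E) 1 × Ioi (0 : ℝ) => g x.2) (hg'.comp measurable_snd)]
        simp
    _ = μ.toSphere univ * ∫⁻ r : Ioi (0 : ℝ), g r ∂.volumeIoiPow (Module.finrank ℝ E - 1) := by
        rw [lintegral_prod (fun x : Metric.sphere (0 : E) 1 × Ioi (0 : ℝ) => g x.2)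
          (hg'.comp measurable_snd).aemeasurable, mul_comm]
        exact lintegral_const (μ := μ.toSphere)
          (∫⁻ r : Ioi (0 : ℝ), g r ∂.volumeIoiPow (Module.finrank ℝ E - 1))
    _ = _ := by
        rw [Measure.volumeIoiPow, lintegral_withDensity_eq_lintegral_mul _ (by fun_prop) hg',
          ← lintegral_subtype_comap measurableSet_Ioi]
        rfl

end Radial

/-! ### Volume and distance in the graph chart -/

namespace HyperbolicSpace

variable {n : ℕ}

theorem hasFDerivAt_graphMap (x : EuclideanSpace ℝ (Fin n)) :
    HasFDerivAt graphMap ((ContinuousLinearMap.id ℝ (EuclideanSpace ℝ (Fin n))).prod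
      ((1 / (2 * √(1 + ‖x‖ ^ 2))) • (2 • innerSL ℝ x))) x := by
  have h : (1 + ‖x‖ ^ 2) ≠ 0 := by positivity
  have h2 : HasFDerivAt (fun y : EuclideanSpace ℝ (Fin n) => 1 + ‖y‖ ^ 2) (2 • innerSL ℝ x) x := by
    simpa using ((hasFDerivAt_id x).norm_sq).const_add 1
  exact (hasFDerivAt_id x).prodMk (h2.sqrt h)

/-- The time coordinate has gradient `x / √(1+|x|²)`, so the metric is the identity minus a rank-one
matrix and its determinant follows from the matrix determinant lemma. -/
theorem metricMatrix_eq (x : EuclideanSpace ℝ (Fin n)) :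
    metricMatrix x = 1 + Matrix.replicateCol Unit (fun i => -(x i / (1 + ‖x‖ ^ 2))) *
      Matrix.replicateRow Unit (fun i => x i) := by
  have h : 0 < 1 + ‖x‖ ^ 2 := by positivity
  ext i j
  simp only [metricMatrix, minkowski, (hasFDerivAt_graphMap x).fderiv, Matrix.of_apply,
    Matrix.add_apply, Matrix.one_apply, Matrix.mul_apply, Finset.univ_unique,
    Finset.sum_singleton, Matrix.replicateCol_apply, Matrix.replicateRow_apply,
    ContinuousLinearMap.prod_apply, ContinuousLinearMap.id_apply, smul_apply,
    innerSL_apply_apply, EuclideanSpace.inner_single_right, PiLp.single_apply]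
  have hs := Real.mul_self_sqrt h.le
  have hs0 : √(1 + ‖x‖ ^ 2) ≠ 0 := by positivity
  have e : 1 / (2 * √(1 + ‖x‖ ^ 2)) * (2 * x i) * (1 / (2 * √(1 + ‖x‖ ^ 2)) * (2 * x j)) =
      x i / (1 + ‖x‖ ^ 2) * x j := by
    rw [show x i / (1 + ‖x‖ ^ 2) = x i / (√(1 + ‖x‖ ^ 2) * √(1 + ‖x‖ ^ 2)) by rw [hs]]
    field_simp
  by_cases hij : i = j
  · subst hij; simp at e ⊢; linarith
  · simp [hij, Ne.symm hij] at e ⊢; linarith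

theorem det_metricMatrix (x : EuclideanSpace ℝ (Fin n)) :
    (metricMatrix x).det = (1 + ‖x‖ ^ 2)⁻¹ := by
  have h : (1 + ‖x‖ ^ 2) ≠ 0 := by positivity
  rw [metricMatrix_eq, Matrix.det_one_add_replicateCol_mul_replicateRow, dotProduct]
  have : ∑ i, x i * -(x i / (1 + ‖x‖ ^ 2)) = -(‖x‖ ^ 2 / (1 + ‖x‖ ^ 2)) := by
    rw [EuclideanSpace.real_norm_sq_eq, Finset.sum_div, ← Finset.sum_neg_distrib]
    exact Finset.sum_congr rfl fun i _ => by ring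
  rw [this]
  field_simp
  ring

theorem hvol_eq : (hvol : Measure (HyperbolicSpace n)) =
    (volume.withDensity fun x : EuclideanSpace ℝ (Fin n) =>
      ENNReal.ofReal (√(1 + ‖x‖ ^ 2))⁻¹).map param := by
  simp only [hvol, det_metricMatrix, Real.sqrt_inv]

theorem lintegral_hvol {F : HyperbolicSpace n → ℝ≥0∞} (hF : Measurable F) :
    ∫⁻ p, F p ∂hvol = ∫⁻ x : EuclideanSpace ℝ (Fin n),
      ENNReal.ofReal (√(1 + ‖x‖ ^ 2))⁻¹ * F (param x) := by
  rw [hvol_eq, lintegral_map hF measurable_param,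
    lintegral_withDensity_eq_lintegral_mul _ (by fun_prop)
      (g := fun x => F (param x)) (hF.comp measurable_param)]
  rfl

instance : SFinite (hvol : Measure (HyperbolicSpace n)) := by
  rw [hvol_eq]; infer_instance

theorem snd_eq (p : HyperbolicSpace n) : p.1.2 = √(1 + ‖p.1.1‖ ^ 2) := by
  have h := p.2.1
  rw [minkowski, real_inner_self_eq_norm_sq] at h
  rw [eq_comm, Real.sqrt_eq_iff_mul_self_eq_of_pos p.2.2]
  linarith

/-- The reversed Cauchy–Schwarz inequality; it keeps the argument of `Real.arcosh` in the range
where `sinh` can be computed. -/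
theorem one_le_neg_minkowski (p a : HyperbolicSpace n) : 1 ≤ -minkowski p.1 a.1 := by
  have h1 : inner ℝ p.1.1 a.1.1 ≤ ‖p.1.1‖ * ‖a.1.1‖ := real_inner_le_norm _ _
  have h2 : 1 + ‖p.1.1‖ * ‖a.1.1‖ ≤ p.1.2 * a.1.2 := by
    rw [snd_eq p, snd_eq a, ← Real.sqrt_mul (by positivity)]
    refine Real.le_sqrt_of_sq_le ?_
    nlinarith [sq_nonneg (‖p.1.1‖ - ‖a.1.1‖)]
  rw [minkowski]; linarith

/-- The base point `(0, 1)` of the hyperboloid. -/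
noncomputable def origin : HyperbolicSpace n := ⟨(0, 1), by simp [minkowski], by simp⟩

theorem sinh_hdist (p a : HyperbolicSpace n) :
    Real.sinh (hdist p a) = √((minkowski p.1 a.1) ^ 2 - 1) := by
  rw [hdist, Real.sinh_arcosh (one_le_neg_minkowski p a), neg_sq]

theorem measurable_minkowski (a : EuclideanSpace ℝ (Fin n) × ℝ) :
    Measurable fun p : EuclideanSpace ℝ (Fin n) × ℝ => minkowski p a := by
  unfold minkowski; fun_prop

theorem measurable_sinh_hdist (a : HyperbolicSpace n) :
    Measurable fun p : HyperbolicSpace n => Real.sinh (hdist p a) := by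
  simp only [sinh_hdist]
  exact ((((measurable_minkowski a.1).comp measurable_subtype_coe).pow_const 2).sub_const 1).sqrt

theorem sinh_hdist_param_origin (x : EuclideanSpace ℝ (Fin n)) :
    Real.sinh (hdist (param x) origin) = ‖x‖ := by
  rw [sinh_hdist]
  simp only [minkowski, param, origin, graphMap, inner_zero_right, mul_one, zero_sub, neg_sq]
  rw [Real.sq_sqrt (by positivity), add_sub_cancel_left, Real.sqrt_sq (norm_nonneg _)]

end HyperbolicSpace

/-! ### Half-turns of Minkowski space and the future cone -/

namespace HyperbolicSpace

variable {n : ℕ}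

section Minkowski

variable (p p' m : EuclideanSpace ℝ (Fin n) × ℝ) (c : ℝ)

theorem minkowski_comm : minkowski p p' = minkowski p' p := by
  rw [minkowski, minkowski, real_inner_comm, mul_comm p.2]

theorem minkowski_add_left : minkowski (p + p') m = minkowski p m + minkowski p' m := by
  simp only [minkowski, Prod.fst_add, Prod.snd_add, inner_add_left]; ring

theorem minkowski_smul_left : minkowski (c • p) m = c * minkowski p m := by
  simp only [minkowski, Prod.smul_fst, Prod.smul_snd, real_inner_smul_left, smul_eq_mul]; ring

theorem minkowski_neg_left : minkowski (-p) m = -minkowski p m := by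
  rw [← neg_one_smul ℝ p, minkowski_smul_left]; ring

theorem minkowski_add_right : minkowski m (p + p') = minkowski m p + minkowski m p' := by
  simp only [minkowski_comm m, minkowski_add_left]

theorem minkowski_smul_right : minkowski m (c • p) = c * minkowski m p := by
  simp only [minkowski_comm m, minkowski_smul_left]

theorem minkowski_neg_right : minkowski m (-p) = -minkowski m p := by
  simp only [minkowski_comm m, minkowski_neg_left]

theorem minkowski_origin : minkowski p (origin (n := n)).1 = -p.2 := by
  simp [minkowski, origin]

/-- The half-turn of Minkowski space about the line spanned by `m`. -/
noncomputable def halfTurn (m : EuclideanSpace ℝ (Fin n) × ℝ) :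
    (EuclideanSpace ℝ (Fin n) × ℝ) →ₗ[ℝ] EuclideanSpace ℝ (Fin n) × ℝ where
  toFun p := -p + (2 / minkowski m m * minkowski p m) • m
  map_add' p p' := by rw [minkowski_add_left, mul_add, add_smul, neg_add]; abel
  map_smul' c p := by
    rw [minkowski_smul_left, RingHom.id_apply, smul_add, smul_neg, smul_smul]
    congr 2; ring

theorem halfTurn_apply : halfTurn m p = -p + (2 / minkowski m m * minkowski p m) • m := rfl

variable {m}

theorem minkowski_halfTurn (hm : minkowski m m ≠ 0) :
    minkowski (halfTurn m p) (halfTurn m p') = minkowski p p' := by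
  simp only [halfTurn_apply, minkowski_add_left, minkowski_add_right, minkowski_smul_left,
    minkowski_smul_right, minkowski_neg_left, minkowski_neg_right, minkowski_comm m p']
  field_simp
  ring

theorem halfTurn_halfTurn (hm : minkowski m m ≠ 0) : halfTurn m (halfTurn m p) = p := by
  have h : minkowski (halfTurn m p) m = minkowski p m := by
    rw [halfTurn_apply, minkowski_add_left, minkowski_smul_left, minkowski_neg_left]
    field_simp
    ring
  rw [halfTurn_apply, h, halfTurn_apply]
  abel

/-- A linear involution has determinant `1` or `-1`. -/
theorem measurePreserving_halfTurn (hm : minkowski m m ≠ 0) :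
    MeasurePreserving (halfTurn m) volume volume := by
  have hc : halfTurn m * halfTurn m = 1 := LinearMap.ext fun p => halfTurn_halfTurn p hm
  have hd : LinearMap.det (halfTurn m) * LinearMap.det (halfTurn m) = 1 := by
    rw [← map_mul, hc, map_one]
  have hd0 : LinearMap.det (halfTurn m) ≠ 0 := left_ne_zero_of_mul_eq_one hd
  have habs : |(LinearMap.det (halfTurn m))⁻¹| = 1 := by
    rcases mul_self_eq_one_iff.1 hd with h | h <;> simp [h]
  have : Measure.IsAddHaarMeasure (volume : Measure (EuclideanSpace ℝ (Fin n) × ℝ)) :=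
    inferInstanceAs (Measure.IsAddHaarMeasure
      ((volume : Measure (EuclideanSpace ℝ (Fin n))).prod (volume : Measure ℝ)))
  refine ⟨(halfTurn m).continuous_of_finiteDimensional.measurable, ?_⟩
  rw [Measure.map_linearMap_addHaar_eq_smul_addHaar _ hd0, habs, ENNReal.ofReal_one, one_smul]

end Minkowski

/-- The open future cone of Minkowski space. -/
def futureCone (n : ℕ) : Set (EuclideanSpace ℝ (Fin n) × ℝ) := {p | ‖p.1‖ < p.2}

theorem measurableSet_futureCone : MeasurableSet (futureCone n) :=
  measurableSet_lt (by fun_prop) (by fun_prop)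

theorem mem_futureCone_iff {p : EuclideanSpace ℝ (Fin n) × ℝ} :
    p ∈ futureCone n ↔ minkowski p p < 0 ∧ 0 < p.2 := by
  simp only [futureCone, Set.mem_ofPred_eq, minkowski, real_inner_self_eq_norm_sq]
  constructor
  · intro h
    have := norm_nonneg p.1
    exact ⟨by nlinarith, by linarith⟩
  · rintro ⟨h1, h2⟩
    by_contra! h
    nlinarith

theorem minkowski_neg_of_mem_futureCone {p p' : EuclideanSpace ℝ (Fin n) × ℝ}
    (hp : p ∈ futureCone n) (hp' : p' ∈ futureCone n) : minkowski p p' < 0 := by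
  have h1 : inner ℝ p.1 p'.1 ≤ ‖p.1‖ * ‖p'.1‖ := real_inner_le_norm _ _
  have h2 : ‖p.1‖ * ‖p'.1‖ < p.2 * p'.2 :=
    mul_lt_mul'' hp hp' (norm_nonneg _) (norm_nonneg _)
  rw [minkowski]; linarith

theorem mem_futureCone (p : HyperbolicSpace n) : p.1 ∈ futureCone n :=
  mem_futureCone_iff.2 ⟨by rw [p.2.1]; norm_num, p.2.2⟩

/-- A linear isometry of Minkowski space that maps `a` to the origin of the hyperboloid. -/
noncomputable def toOrigin (a : HyperbolicSpace n) :
    (EuclideanSpace ℝ (Fin n) × ℝ) →ₗ[ℝ] EuclideanSpace ℝ (Fin n) × ℝ :=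
  halfTurn (a.1 + origin.1)

section ToOrigin

variable (a : HyperbolicSpace n)

theorem minkowski_add_origin_self :
    minkowski (a.1 + origin.1) (a.1 + origin.1) = 2 * minkowski a.1 (a.1 + origin.1) := by
  simp only [minkowski_add_left, minkowski_add_right, a.2.1, (origin (n := n)).2.1,
    minkowski_comm (origin (n := n)).1 a.1]
  ring

theorem minkowski_add_origin_self_ne_zero :
    minkowski (a.1 + origin.1) (a.1 + origin.1) ≠ 0 := by
  rw [minkowski_add_origin_self, minkowski_add_right, a.2.1, minkowski_origin]
  have := a.2.2
  intro h
  linarith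

/-- The axis `a + origin` bisects two vectors of equal Minkowski norm, so the half-turn swaps them.
-/
theorem toOrigin_self : toOrigin a a.1 = origin.1 := by
  have h := minkowski_add_origin_self_ne_zero a
  rw [minkowski_add_origin_self] at h
  rw [toOrigin, halfTurn_apply, minkowski_add_origin_self, div_mul_eq_mul_div, div_self h, one_smul]
  abel

theorem minkowski_toOrigin (p : EuclideanSpace ℝ (Fin n) × ℝ) :
    minkowski (toOrigin a p) (toOrigin a p) = minkowski p p :=
  minkowski_halfTurn _ _ (minkowski_add_origin_self_ne_zero a)

theorem minkowski_toOrigin_origin (p : EuclideanSpace ℝ (Fin n) × ℝ) :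
    minkowski (toOrigin a p) (origin (n := n)).1 = minkowski p a.1 := by
  rw [← toOrigin_self a]
  exact minkowski_halfTurn _ _ (minkowski_add_origin_self_ne_zero a)

/-- The new time coordinate is `-⟨p, a⟩`, positive for two vectors of the future cone. -/
theorem toOrigin_mem_futureCone {p : EuclideanSpace ℝ (Fin n) × ℝ} (hp : p ∈ futureCone n) :
    toOrigin a p ∈ futureCone n := by
  rw [mem_futureCone_iff, minkowski_toOrigin]
  refine ⟨(mem_futureCone_iff.1 hp).1, ?_⟩
  have h1 := minkowski_toOrigin_origin a p
  have h2 := minkowski_neg_of_mem_futureCone hp (mem_futureCone a)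
  rw [minkowski_origin] at h1
  linarith

theorem toOrigin_preimage_futureCone : toOrigin a ⁻¹' futureCone n = futureCone n := by
  refine Set.Subset.antisymm (fun p hp => ?_) fun p hp => toOrigin_mem_futureCone a hp
  have := toOrigin_mem_futureCone a hp
  rwa [toOrigin, halfTurn_halfTurn _ (minkowski_add_origin_self_ne_zero a)] at this

end ToOrigin

/-! ### Integration over the cone and independence of the centre -/

section Cone
open Set

/-- With `b = |y|` this reparametrizes the fibre `t > |y|` of the cone by the Minkowski radius `s =
√(t² - |y|²)`. -/
theorem lintegral_Ioi_eq_lintegral_sqrt {b : ℝ} (hb : 0 ≤ b) (g : ℝ → ℝ≥0∞) :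
    ∫⁻ t in Ioi b, g t =
      ∫⁻ s in Ioi (0 : ℝ), ENNReal.ofReal (s / √(s ^ 2 + b ^ 2)) * g √(s ^ 2 + b ^ 2) := by
  have himg : (fun s : ℝ => √(s ^ 2 + b ^ 2)) '' Ioi 0 = Ioi b := by
    ext t
    simp only [mem_image, mem_Ioi]
    constructor
    · rintro ⟨s, hs, rfl⟩
      exact Real.lt_sqrt_of_sq_lt (by nlinarith)
    · intro ht
      refine ⟨√(t ^ 2 - b ^ 2), Real.sqrt_pos.2 (by nlinarith), ?_⟩
      rw [Real.sq_sqrt (by nlinarith), sub_add_cancel, Real.sqrt_sq (by linarith)]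
  have hinj : InjOn (fun s : ℝ => √(s ^ 2 + b ^ 2)) (Ioi 0) := by
    intro s hs t ht h
    have hs : 0 < s := hs
    have ht : 0 < t := ht
    have := (Real.sqrt_inj (by positivity) (by positivity)).1 h
    exact (pow_left_inj₀ hs.le ht.le two_ne_zero).1 (by linarith)
  have hderiv : ∀ s ∈ Ioi (0 : ℝ),
      HasDerivWithinAt (fun s : ℝ => √(s ^ 2 + b ^ 2)) (s / √(s ^ 2 + b ^ 2)) (Ioi 0) s := by
    intro s hs
    have hs : 0 < s := hs
    have h1 : HasDerivAt (fun s : ℝ => s ^ 2 + b ^ 2) (2 * s) s := by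
      simpa using (hasDerivAt_pow 2 s).add_const (b ^ 2)
    have h2 := (h1.sqrt (by positivity)).hasDerivWithinAt (s := Ioi 0)
    rwa [mul_div_mul_left _ _ two_ne_zero] at h2
  rw [← himg, lintegral_image_eq_lintegral_abs_deriv_mul measurableSet_Ioi hderiv hinj]
  refine setLIntegral_congr_fun measurableSet_Ioi fun s hs => ?_
  have hs : 0 < s := hs
  rw [abs_of_nonneg (by positivity)]

theorem lintegral_eq_pow_mul_lintegral_comp_smul {s : ℝ} (hs : 0 < s)
    {h : EuclideanSpace ℝ (Fin n) → ℝ≥0∞} (hh : Measurable h) :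
    ∫⁻ y, h y = ENNReal.ofReal (s ^ n) * ∫⁻ x, h (s • x) := by
  have hsn : 0 < s ^ n := pow_pos hs n
  have hmap := Measure.map_addHaar_smul (volume : Measure (EuclideanSpace ℝ (Fin n))) hs.ne'
  rw [finrank_euclideanSpace_fin, abs_of_pos (inv_pos.2 hsn)] at hmap
  rw [← lintegral_map hh (measurable_const_smul s), hmap, lintegral_smul_measure, smul_eq_mul,
    ← mul_assoc, ← ENNReal.ofReal_mul hsn.le, mul_inv_cancel₀ hsn.ne', ENNReal.ofReal_one, one_mul]

/-- Integration over the future cone in polar coordinates. -/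
theorem setLIntegral_futureCone {F : EuclideanSpace ℝ (Fin n) × ℝ → ℝ≥0∞} (hF : Measurable F) :
    ∫⁻ p in futureCone n, F p =
      ∫⁻ s in Ioi (0 : ℝ), ENNReal.ofReal (s ^ n) * ∫⁻ p, F (s • p.1) ∂hvol := by
  set K : EuclideanSpace ℝ (Fin n) → ℝ → ℝ≥0∞ := fun y s =>
    ENNReal.ofReal (s / √(s ^ 2 + ‖y‖ ^ 2)) * F (y, √(s ^ 2 + ‖y‖ ^ 2)) with hK
  have hKm : Measurable (Function.uncurry K) := by
    have h1 : Measurable fun p : EuclideanSpace ℝ (Fin n) × ℝ => √(p.2 ^ 2 + ‖p.1‖ ^ 2) := by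
      fun_prop
    exact ((measurable_snd.div h1).ennreal_ofReal).mul (hF.comp (measurable_fst.prodMk h1))
  calc ∫⁻ p in futureCone n, F p
      = ∫⁻ y, ∫⁻ t, (futureCone n).indicator F (y, t) := by
        rw [← lintegral_indicator measurableSet_futureCone, Measure.volume_eq_prod,
          lintegral_prod _ (hF.indicator measurableSet_futureCone).aemeasurable]
    _ = ∫⁻ y, ∫⁻ s in Ioi (0 : ℝ), K y s := by
        refine lintegral_congr fun y => ?_
        rw [← lintegral_Ioi_eq_lintegral_sqrt (norm_nonneg y) fun t => F (y, t),
          ← lintegral_indicator measurableSet_Ioi]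
        rfl
    _ = ∫⁻ s in Ioi (0 : ℝ), ∫⁻ y, K y s := lintegral_lintegral_swap hKm.aemeasurable
    _ = _ := by
        refine setLIntegral_congr_fun measurableSet_Ioi fun s hs => ?_
        have hs : 0 < s := hs
        have hFs : Measurable fun p : HyperbolicSpace n => F (s • p.1) :=
          hF.comp (measurable_subtype_coe.const_smul s)
        -- The substitution `y = s x` turns `s / √(s² + |y|²)` into the density `1 / √(1 + |x|²)` of
        -- `hvol` and produces the factor `s^n`.
        rw [lintegral_eq_pow_mul_lintegral_comp_smul (h := fun y => K y s) hs
          (hKm.comp (measurable_id.prodMk measurable_const)),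
          lintegral_hvol hFs]
        congr 1
        refine lintegral_congr fun x => ?_
        have h1 : √(s ^ 2 + ‖s • x‖ ^ 2) = s * √(1 + ‖x‖ ^ 2) := by
          rw [norm_smul, Real.norm_of_nonneg hs.le,
            show s ^ 2 + (s * ‖x‖) ^ 2 = s ^ 2 * (1 + ‖x‖ ^ 2) by ring,
            Real.sqrt_mul (by positivity), Real.sqrt_sq hs.le]
        simp only [hK]
        rw [h1, div_mul_eq_div_div, div_self hs.ne', one_div]
        rfl

/-- The integrand is homogeneous of degree zero, so it does not see the radius; cutting off at
radius `1` leaves a finite nonzero radial factor that can be cancelled. -/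
theorem lintegral_hvol_minkowski_eq_futureCone {g : ℝ → ℝ≥0∞} (hg : Measurable g)
    (a : HyperbolicSpace n) :
    ∫⁻ p in futureCone n, {p | -1 < minkowski p p}.indicator
        (fun p => g (-minkowski p a.1 / √(-minkowski p p))) p =
      (∫⁻ s in Ioo (0 : ℝ) 1, ENNReal.ofReal (s ^ n)) *
        ∫⁻ p : HyperbolicSpace n, g (-minkowski p.1 a.1) ∂hvol := by
  have hself : Measurable fun p : EuclideanSpace ℝ (Fin n) × ℝ => minkowski p p := by
    unfold minkowski; fun_prop
  have hm : Measurable fun p : EuclideanSpace ℝ (Fin n) × ℝ =>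
      g (-minkowski p a.1 / √(-minkowski p p)) :=
    hg.comp ((measurable_minkowski a.1).neg.div hself.neg.sqrt)
  rw [setLIntegral_futureCone (hm.indicator (measurableSet_lt measurable_const hself)),
    ← lintegral_mul_const _ (by fun_prop), ← lintegral_indicator measurableSet_Ioi,
    ← lintegral_indicator measurableSet_Ioo]
  refine lintegral_congr fun s => ?_
  by_cases hs : 0 < s
  · have hB : ∀ p : HyperbolicSpace n, minkowski (s • p.1) (s • p.1) = -s ^ 2 := fun p => by
      rw [minkowski_smul_left, minkowski_smul_right, p.2.1]; ring
    rw [indicator_of_mem (mem_Ioi.2 hs)]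
    by_cases hs1 : s < 1
    · rw [indicator_of_mem (mem_Ioo.2 ⟨hs, hs1⟩)]
      congr 1
      refine lintegral_congr fun p => ?_
      rw [indicator_of_mem (by rw [mem_ofPred_eq, hB]; nlinarith), hB, neg_neg, Real.sqrt_sq hs.le,
        minkowski_smul_left, ← mul_neg, mul_div_cancel_left₀ _ hs.ne']
    · rw [indicator_of_notMem (by simp [hs1])]
      rw [lintegral_congr (g := 0) fun p => ?_]
      · simp
      · rw [indicator_of_notMem (by rw [mem_ofPred_eq, hB]; nlinarith)]
        rfl
  · rw [indicator_of_notMem (by simpa using hs), indicator_of_notMem (by simp [hs])]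

/-- The volume distribution of the distance to a point does not depend on the point. -/
theorem lintegral_hvol_minkowski {g : ℝ → ℝ≥0∞} (hg : Measurable g) (a : HyperbolicSpace n) :
    ∫⁻ p : HyperbolicSpace n, g (-minkowski p.1 a.1) ∂hvol =
      ∫⁻ p : HyperbolicSpace n, g (-minkowski p.1 (origin (n := n)).1) ∂hvol := by
  have hκ0 : (∫⁻ s in Ioo (0 : ℝ) 1, ENNReal.ofReal (s ^ n)) ≠ 0 := by
    rw [← pos_iff_ne_zero, setLIntegral_pos_iff (by fun_prop)]
    refine lt_of_lt_of_le (b := volume (Ioo (0 : ℝ) 1)) (by simp) (measure_mono fun s hs => ?_)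
    exact ⟨by simpa using pow_pos hs.1 n, hs⟩
  have hκ1 : (∫⁻ s in Ioo (0 : ℝ) 1, ENNReal.ofReal (s ^ n)) ≠ ∞ := by
    refine ((setLIntegral_mono' (g := fun _ => 1) measurableSet_Ioo fun s hs => ?_).trans_lt ?_).ne
    · exact ENNReal.ofReal_le_one.2 (pow_le_one₀ hs.1.le hs.2.le)
    · simp
  -- Both sides become Lebesgue integrals over the cone, related by the measure-preserving map
  -- `toOrigin a`.
  refine (ENNReal.mul_right_inj hκ0 hκ1).1 ?_
  rw [← lintegral_hvol_minkowski_eq_futureCone hg, ← lintegral_hvol_minkowski_eq_futureCone hg]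
  have hself : Measurable fun p : EuclideanSpace ℝ (Fin n) × ℝ => minkowski p p := by
    unfold minkowski; fun_prop
  have hm : Measurable ({p : EuclideanSpace ℝ (Fin n) × ℝ | -1 < minkowski p p}.indicator
      fun p => g (-minkowski p (origin (n := n)).1 / √(-minkowski p p))) :=
    (hg.comp ((measurable_minkowski _).neg.div hself.neg.sqrt)).indicator
      (measurableSet_lt measurable_const hself)
  have hmp : MeasurePreserving (toOrigin a) volume volume :=
    measurePreserving_halfTurn (minkowski_add_origin_self_ne_zero a)
  rw [← hmp.setLIntegral_comp_preimage measurableSet_futureCone hm, toOrigin_preimage_futureCone]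
  refine lintegral_congr fun p => ?_
  simp only [indicator, mem_ofPred_eq, minkowski_toOrigin, minkowski_toOrigin_origin]

end Cone

end HyperbolicSpace

/-! ### Geodesic polar coordinates and annuli -/

namespace HyperbolicSpace

open Set

variable {n : ℕ}

/-- The area of the unit sphere of `ℝⁿ`. -/
noncomputable def sphereArea (n : ℕ) : ℝ≥0∞ :=
  (volume : Measure (EuclideanSpace ℝ (Fin n))).toSphere univ

theorem nontrivial_euclideanSpace (hn : 1 ≤ n) : Nontrivial (EuclideanSpace ℝ (Fin n)) :=
  have : Nonempty (Fin n) := ⟨⟨0, hn⟩⟩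
  inferInstance

theorem sphereArea_ne_zero (hn : 1 ≤ n) : sphereArea n ≠ 0 := by
  have := nontrivial_euclideanSpace hn
  rw [sphereArea, Ne, Measure.measure_univ_eq_zero]
  exact Measure.toSphere_ne_zero _

theorem sphereArea_ne_top : sphereArea n ≠ ∞ := measure_ne_top _ _

/-- Integration of radial functions in geodesic polar coordinates, in the variable
`r = sinh |x|_a`. -/
theorem lintegral_hvol_sinh_hdist (hn : 1 ≤ n) (a : HyperbolicSpace n) {g : ℝ → ℝ≥0∞}
    (hg : Measurable g) :
    ∫⁻ p, g (Real.sinh (hdist p a)) ∂hvol = sphereArea n *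
      ∫⁻ r in Ioi (0 : ℝ), ENNReal.ofReal (r ^ (n - 1) / √(1 + r ^ 2)) * g r := by
  have := nontrivial_euclideanSpace hn
  have hg' : Measurable fun t : ℝ => g √(t ^ 2 - 1) := hg.comp (by fun_prop)
  calc ∫⁻ p, g (Real.sinh (hdist p a)) ∂hvol
      = ∫⁻ p : HyperbolicSpace n, g (Real.sinh (hdist p origin)) ∂hvol := by
        have h := lintegral_hvol_minkowski hg' a
        simpa only [neg_sq, ← sinh_hdist] using h
    _ = ∫⁻ x : EuclideanSpace ℝ (Fin n),
          (fun r : ℝ => ENNReal.ofReal (√(1 + r ^ 2))⁻¹ * g r) ‖x‖ := by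
        rw [lintegral_hvol (F := fun p => g (Real.sinh (hdist p origin)))
          (hg.comp (measurable_sinh_hdist _))]
        simp only [sinh_hdist_param_origin]
    _ = _ := by
        rw [lintegral_comp_norm_addHaar _
          (g := fun r : ℝ => ENNReal.ofReal (√(1 + r ^ 2))⁻¹ * g r) (by fun_prop), finrank_euclideanSpace_fin, sphereArea]
        congr 1
        refine setLIntegral_congr_fun measurableSet_Ioi fun r hr => ?_
        have hr : 0 < r := hr
        rw [← mul_assoc, ← ENNReal.ofReal_mul (by positivity), ← div_eq_mul_inv]

theorem setLIntegral_hvol_sinh_hdist (hn : 1 ≤ n) (a : HyperbolicSpace n) {g : ℝ → ℝ≥0∞}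
    (hg : Measurable g) {t : Set ℝ} (ht : MeasurableSet t) (ht0 : t ⊆ Ioi 0) :
    ∫⁻ p in {p | Real.sinh (hdist p a) ∈ t}, g (Real.sinh (hdist p a)) ∂hvol = sphereArea n *
      ∫⁻ r in t, ENNReal.ofReal (r ^ (n - 1) / √(1 + r ^ 2)) * g r := by
  have h := lintegral_hvol_sinh_hdist hn a (hg.indicator ht)
  have hm : MeasurableSet {p : HyperbolicSpace n | Real.sinh (hdist p a) ∈ t} :=
    measurable_sinh_hdist a ht
  rw [← lintegral_indicator hm]
  refine Eq.trans ?_ (h.trans ?_)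
  · rfl
  · congr 1
    rw [← inter_eq_self_of_subset_left ht0, ← setLIntegral_indicator ht]
    refine lintegral_congr fun r => ?_
    by_cases hr : r ∈ t <;> simp [hr, inter_eq_self_of_subset_left ht0]

theorem ae_sinh_hdist_pos (hn : 1 ≤ n) (a : HyperbolicSpace n) :
    ∀ᵐ p ∂(hvol : Measure (HyperbolicSpace n)), 0 < Real.sinh (hdist p a) := by
  have hm : MeasurableSet {p : HyperbolicSpace n | Real.sinh (hdist p a) ∈ Iic 0} :=
    measurable_sinh_hdist a measurableSet_Iic
  have h := lintegral_hvol_sinh_hdist hn a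
    ((measurable_const (a := (1 : ℝ≥0∞))).indicator (measurableSet_Iic (a := (0 : ℝ))))
  rw [setLIntegral_congr_fun (g := 0) measurableSet_Ioi fun r hr => ?_] at h
  · simp only [Pi.zero_apply, lintegral_zero, mul_zero] at h
    have h2 : hvol {p : HyperbolicSpace n | Real.sinh (hdist p a) ∈ Iic 0} = 0 := by
      rw [← lintegral_indicator_one hm]; exact h
    rw [ae_iff]
    simpa only [not_lt, mem_Iic] using h2
  · have hr : 0 < r := hr
    simp [hr]

/-- As `sinh` is increasing, balls are sublevel sets of `sinh |y|_a`, the form needed in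
`lintegral_sublevel_rpow_le`. -/
theorem hball_hdist (a x : HyperbolicSpace n) :
    hball a (hdist x a) = {y | Real.sinh (hdist y a) ≤ Real.sinh (hdist x a)} := by
  simp only [hball, Real.sinh_le_sinh]

theorem setLIntegral_sinh_hdist_rpow (hn : 1 ≤ n) (a : HyperbolicSpace n) (δ : ℝ) {s : ℝ}
    (hs : 0 < s) :
    ∫⁻ x in {x | s ≤ Real.sinh (hdist x a)}, ENNReal.ofReal (Real.sinh (hdist x a) ^ δ) ∂hvol =
      sphereArea n * hypTail (n + δ) s := by
  have h := setLIntegral_hvol_sinh_hdist hn a (g := fun r => ENNReal.ofReal (r ^ δ)) (by fun_prop)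
    (measurableSet_Ici (a := s)) (fun r hr => hs.trans_le hr)
  refine h.trans ?_
  rw [hypTail, setLIntegral_congr Ioi_ae_eq_Ici.symm]
  congr 1
  refine setLIntegral_congr_fun measurableSet_Ioi fun r hr => ?_
  have hr : 0 < r := hs.trans hr
  rw [← ENNReal.ofReal_mul (by positivity), div_mul_eq_mul_div, ← Real.rpow_natCast,
    ← Real.rpow_add hr, Nat.cast_sub hn, Nat.cast_one]
  ring_nf

theorem hvol_annulus (hn : 1 ≤ n) (a : HyperbolicSpace n) {s t : ℝ} (hs : 0 < s) :
    hvol {x | Real.sinh (hdist x a) ∈ Icc s t} =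
      sphereArea n * ∫⁻ r in Icc s t, ENNReal.ofReal (r ^ (n - 1) / √(1 + r ^ 2)) := by
  have h := setLIntegral_hvol_sinh_hdist hn a (g := fun _ => 1) measurable_const
    (measurableSet_Icc (a := s) (b := t)) (fun r hr => hs.trans_le hr.1)
  simpa using h

theorem hvol_annulus_ne_zero (hn : 1 ≤ n) (a : HyperbolicSpace n) {s t : ℝ} (hs : 0 < s)
    (hst : s < t) : hvol {x | Real.sinh (hdist x a) ∈ Icc s t} ≠ 0 := by
  rw [hvol_annulus hn a hs]
  refine mul_ne_zero (sphereArea_ne_zero hn) ?_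
  rw [← pos_iff_ne_zero, setLIntegral_pos_iff (by fun_prop)]
  refine lt_of_lt_of_le (b := volume (Icc s t)) (by simpa using hst) (measure_mono fun r hr => ?_)
  have hr0 : 0 < r := hs.trans_le hr.1
  refine ⟨?_, hr⟩
  have : 0 < r ^ (n - 1) / √(1 + r ^ 2) := by positivity
  simpa using this

theorem hvol_annulus_ne_top (hn : 1 ≤ n) (a : HyperbolicSpace n) {s t : ℝ} (hs : 0 < s) :
    hvol {x | Real.sinh (hdist x a) ∈ Icc s t} ≠ ∞ := by
  rw [hvol_annulus hn a hs]
  refine ENNReal.mul_ne_top sphereArea_ne_top ?_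
  refine ((setLIntegral_mono' (g := fun _ => ENNReal.ofReal (t ^ (n - 1))) measurableSet_Icc
    fun r hr => ENNReal.ofReal_le_ofReal ?_).trans_lt ?_).ne
  · have hr0 : 0 < r := hs.trans_le hr.1
    refine (div_le_self (by positivity) (one_le_sqrt_one_add_sq r)).trans ?_
    exact pow_le_pow_left₀ hr0.le hr.2 _
  · rw [setLIntegral_const, Real.volume_Icc]
    exact ENNReal.mul_lt_top ENNReal.ofReal_lt_top ENNReal.ofReal_lt_top

theorem rpow_le_max_mul_rpow {α r s : ℝ} (hs : 0 < s) (h1 : s / 2 ≤ r) (h2 : r ≤ s) :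
    r ^ α ≤ max 1 (2 ^ (-α)) * s ^ α := by
  have hr : 0 < r := by linarith
  rcases le_total 0 α with h | h
  · calc r ^ α ≤ 1 * s ^ α := by rw [one_mul]; exact Real.rpow_le_rpow hr.le h2 h
      _ ≤ _ := by gcongr; exact le_max_left _ _
  · calc r ^ α ≤ (s / 2) ^ α := Real.rpow_le_rpow_of_nonpos (by positivity) h1 h
      _ = 2 ^ (-α) * s ^ α := by
        rw [Real.div_rpow hs.le zero_le_two, Real.rpow_neg zero_le_two]; ring
      _ ≤ _ := by gcongr; exact le_max_right _ _

theorem ofReal_rpow_mul {x α q : ℝ} (hx : 0 ≤ x) (hq : 0 ≤ q) :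
    ENNReal.ofReal (x ^ α) ^ q = ENNReal.ofReal (x ^ (α * q)) := by
  rw [ENNReal.ofReal_rpow_of_nonneg (Real.rpow_nonneg hx _) hq, Real.rpow_mul hx]

/-! ### The Hardy inequality and the tail bound -/

/-- A bound for the tail integrals implies the Hardy inequality with power weights. -/
theorem l1HardyInequality_of_hypTail_le (hn : 1 ≤ n) (a : HyperbolicSpace n) {α δ q : ℝ}
    (hq : 1 ≤ q) {C : ℝ≥0}
    (hC : ∀ s : ℝ, 0 < s → hypTail (n + δ) s ≤ C * ENNReal.ofReal (s ^ (α * q))) :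
    L1HardyInequality a q (fun x => Real.sinh (hdist x a) ^ δ)
      (fun x => Real.sinh (hdist x a) ^ α) := by
  have hq0 : 0 < q := by linarith
  have hρ := measurable_sinh_hdist a
  set c : ℝ≥0 := (sphereArea n).toNNReal with hc
  have hcc : (c : ℝ≥0∞) = sphereArea n := ENNReal.coe_toNNReal sphereArea_ne_top
  have hc0 : c ≠ 0 := fun h => sphereArea_ne_zero hn (by rw [← hcc, h, ENNReal.coe_zero])
  set D : ℝ≥0 := (c * (C + 1)) ^ (1 / q) with hD
  have hD0 : D ≠ 0 := by
    have : 0 < c := pos_iff_ne_zero.2 hc0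
    have : 0 < D := NNReal.rpow_pos (by positivity)
    exact this.ne'
  have hDq : (D : ℝ≥0∞) ^ q = sphereArea n * (C + 1) := by
    rw [← ENNReal.coe_rpow_of_nonneg _ hq0.le, hD, ← NNReal.rpow_mul, one_div_mul_cancel hq0.ne',
      NNReal.rpow_one]
    push_cast
    rw [hcc]
  refine ⟨D, fun f hf => ?_⟩
  set V : HyperbolicSpace n → ℝ≥0∞ := fun y => ENNReal.ofReal (Real.sinh (hdist y a) ^ α) with hV
  have hVm : Measurable V := (hρ.pow_const α).ennreal_ofReal
  have key := lintegral_sublevel_rpow_le (μ := hvol) hρ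
    (U := fun x => ENNReal.ofReal (Real.sinh (hdist x a) ^ δ)) (W := fun y => D * V y)
    (F := fun y => ‖f y‖ₑ) (hρ.pow_const δ).ennreal_ofReal (hVm.const_mul _) hf.enorm hq ?_ ?_ ?_
  · calc _ ≤ ((∫⁻ y, ‖f y‖ₑ * (D * V y) ∂hvol) ^ q) ^ (1 / q) := by
          simp only [hball_hdist]
          gcongr
      _ = ∫⁻ y, D * (‖f y‖ₑ * V y) ∂hvol := by
          rw [← ENNReal.rpow_mul, mul_one_div_cancel hq0.ne', ENNReal.rpow_one]
          exact lintegral_congr fun y => mul_left_comm _ _ _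
      _ = _ := lintegral_const_mul _ (hf.enorm.mul hVm)
  · filter_upwards [ae_sinh_hdist_pos hn a] with y hy
    refine mul_ne_zero (ENNReal.coe_ne_zero.2 hD0) ?_
    simpa [hV] using Real.rpow_pos_of_pos hy α
  · exact Filter.Eventually.of_forall fun y =>
      ENNReal.mul_ne_top ENNReal.coe_ne_top ENNReal.ofReal_ne_top
  · filter_upwards [ae_sinh_hdist_pos hn a] with y hy
    rw [setLIntegral_sinh_hdist_rpow hn a δ hy, ENNReal.mul_rpow_of_nonneg _ _ hq0.le, hDq,
      ofReal_rpow_mul hy.le hq0.le, mul_assoc]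
    gcongr
    refine (hC _ hy).trans ?_
    gcongr
    exact le_self_add

/-- Testing the Hardy inequality with power weights on annuli bounds the tail integrals. -/
theorem exists_hypTail_le_of_l1HardyInequality (hn : 1 ≤ n) (a : HyperbolicSpace n) {α δ q : ℝ}
    (hq : 1 ≤ q)
    (H : L1HardyInequality a q (fun x => Real.sinh (hdist x a) ^ δ)
      (fun x => Real.sinh (hdist x a) ^ α)) :
    ∃ C : ℝ≥0, ∀ s : ℝ, 0 < s → hypTail (n + δ) s ≤ C * ENNReal.ofReal (s ^ (α * q)) := by
  have hq0 : 0 < q := by linarith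
  have hρ := measurable_sinh_hdist a
  obtain ⟨C, hC⟩ := H
  set B : ℝ := max 1 (2 ^ (-α)) with hB
  have hB0 : 0 ≤ B := zero_le_one.trans (le_max_left _ _)
  set E : ℝ≥0∞ := (sphereArea n)⁻¹ * (C * ENNReal.ofReal B) ^ q with hE
  have hEtop : E ≠ ∞ := ENNReal.mul_ne_top (ENNReal.inv_ne_top.2 (sphereArea_ne_zero hn))
    (ENNReal.rpow_ne_top_of_nonneg hq0.le (ENNReal.mul_ne_top ENNReal.coe_ne_top
      ENNReal.ofReal_ne_top))
  refine ⟨E.toNNReal, fun s hs => ?_⟩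
  rw [ENNReal.coe_toNNReal hEtop]
  -- The annulus replaces a point mass at radius `s`: it lies in every ball of radius at least that
  -- of the sphere `sinh |x|_a = s`, and the weight on it is at most `B * s^α`.
  set A : Set (HyperbolicSpace n) := {x | Real.sinh (hdist x a) ∈ Icc (s / 2) s} with hA
  have hAm : MeasurableSet A := hρ measurableSet_Icc
  have hM0 : hvol A ≠ 0 := hvol_annulus_ne_zero hn a (by positivity) (by linarith)
  have hMtop : hvol A ≠ ∞ := hvol_annulus_ne_top hn a (by positivity)
  have hfA : ∀ y, ‖A.indicator (fun _ => (1 : ℂ)) y‖ₑ = A.indicator 1 y := fun y => by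
    by_cases hy : y ∈ A <;> simp [hy]
  have htest := hC (A.indicator fun _ => 1) (measurable_const.indicator hAm)
  simp only [hfA, hball_hdist] at htest
  have hSm : MeasurableSet {x : HyperbolicSpace n | s ≤ Real.sinh (hdist x a)} :=
    hρ measurableSet_Ici
  have hlow : hvol A ^ q * (sphereArea n * hypTail (n + δ) s) ≤
      ∫⁻ x, (∫⁻ y in {y | Real.sinh (hdist y a) ≤ Real.sinh (hdist x a)}, A.indicator 1 y ∂hvol) ^ q
        * ENNReal.ofReal (Real.sinh (hdist x a) ^ δ) ∂hvol := by
    rw [← setLIntegral_sinh_hdist_rpow hn a δ hs,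
      ← lintegral_const_mul _ (hρ.pow_const δ).ennreal_ofReal]
    refine le_trans (setLIntegral_mono' hSm fun x hx => ?_) (setLIntegral_le_lintegral _ _)
    have hsub : A ⊆ {y | Real.sinh (hdist y a) ≤ Real.sinh (hdist x a)} :=
      fun y hy => hy.2.trans hx
    rw [lintegral_indicator_one hAm, Measure.restrict_apply hAm, inter_eq_self_of_subset_left hsub]
  have hup : ∫⁻ x, A.indicator 1 x * ENNReal.ofReal (Real.sinh (hdist x a) ^ α) ∂hvol ≤
      hvol A * (ENNReal.ofReal B * ENNReal.ofReal (s ^ α)) := by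
    rw [← ENNReal.ofReal_mul hB0, mul_comm (hvol A), ← lintegral_indicator_const hAm]
    refine lintegral_mono fun x => ?_
    by_cases hx : x ∈ A
    · simp only [indicator_of_mem hx, Pi.one_apply, one_mul]
      exact ENNReal.ofReal_le_ofReal (rpow_le_max_mul_rpow hs hx.1 hx.2)
    · simp [hx]
  have hq1 : 0 ≤ 1 / q := by positivity
  have h1 : hvol A * (sphereArea n * hypTail (n + δ) s) ^ (1 / q) ≤
      hvol A * (C * ENNReal.ofReal B * ENNReal.ofReal (s ^ α)) := by
    calc _ = (hvol A ^ q * (sphereArea n * hypTail (n + δ) s)) ^ (1 / q) := by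
          rw [ENNReal.mul_rpow_of_nonneg (hvol A ^ q) _ hq1, ← ENNReal.rpow_mul, mul_one_div_cancel hq0.ne',
            ENNReal.rpow_one]
      _ ≤ _ := by gcongr
      _ ≤ _ := htest
      _ ≤ C * (hvol A * (ENNReal.ofReal B * ENNReal.ofReal (s ^ α))) := by gcongr
      _ = _ := by ring
  -- Both sides are linear in `hvol A`, which is finite and nonzero and so cancels.
  have h2 := ENNReal.rpow_le_rpow ((ENNReal.mul_le_mul_iff_right hM0 hMtop).1 h1) hq0.le
  rw [← ENNReal.rpow_mul, one_div_mul_cancel hq0.ne', ENNReal.rpow_one,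
    ENNReal.mul_rpow_of_nonneg _ _ hq0.le, ofReal_rpow_mul hs.le hq0.le] at h2
  rw [hE, mul_assoc]
  calc hypTail (n + δ) s = (sphereArea n)⁻¹ * (sphereArea n * hypTail (n + δ) s) := by
        rw [← mul_assoc, ENNReal.inv_mul_cancel (sphereArea_ne_zero hn) sphereArea_ne_top, one_mul]
    _ ≤ _ := by gcongr

/-- The Hardy inequality with power weights in terms of the exponents. -/
theorem l1HardyInequality_sinh_rpow_iff (hn : 1 ≤ n) (a : HyperbolicSpace n) (α β : ℝ) {q : ℝ}
    (hq : 1 ≤ q) :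
    L1HardyInequality a q (fun x => Real.sinh (hdist x a) ^ (-β * q))
        (fun x => Real.sinh (hdist x a) ^ α) ↔
      α ≤ 0 ∧ ((n : ℝ) - 1) / q ≤ α + β ∧ ((n : ℝ) - β * q < 0 → α + β ≤ n / q) ∧
        (α = 0 → β ≠ ((n : ℝ) - 1) / q ∧ β ≠ n / q) := by
  have hq0 : 0 < q := by linarith
  have h := hypTail_le_rpow_iff (n + -β * q) (α * q)
  have e1 : α * q ≤ 0 ↔ α ≤ 0 := by
    simpa using mul_le_mul_iff_left₀ (b := α) (c := 0) hq0
  have e2 : (n : ℝ) + -β * q - 1 ≤ α * q ↔ ((n : ℝ) - 1) / q ≤ α + β := by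
    rw [div_le_iff₀ hq0]; constructor <;> intro h <;> linarith
  have e3 : α * q ≤ n + -β * q ↔ α + β ≤ n / q := by
    rw [le_div_iff₀ hq0]; constructor <;> intro h <;> linarith
  have e4 : (n : ℝ) + -β * q = 1 ↔ β = ((n : ℝ) - 1) / q := by
    rw [eq_div_iff hq0.ne']; constructor <;> intro h <;> linarith
  have e5 : (n : ℝ) + -β * q = 0 ↔ β = n / q := by
    rw [eq_div_iff hq0.ne']; constructor <;> intro h <;> linarith
  have e6 : α * q = 0 ↔ α = 0 := by simp [hq0.ne']
  have e7 : (n : ℝ) + -β * q < 0 ↔ (n : ℝ) - β * q < 0 := by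
    constructor <;> intro h <;> linarith
  rw [e1, e2, e3, e6, e7, Ne, Ne, e4, e5] at h
  rw [← h]
  exact ⟨exists_hypTail_le_of_l1HardyInequality hn a hq,
    fun ⟨_, hC⟩ => l1HardyInequality_of_hypTail_le hn a hq hC⟩

end HyperbolicSpace

theorem corollary3p4 (n : ℕ) (hn : 1 ≤ n) (a : HyperbolicSpace n) (α β q : ℝ) (hq : 1 ≤ q) :
    (0 ≤ (n : ℝ) - β * q →
      (HyperbolicSpace.L1HardyInequality a q
          (fun x => Real.sinh (HyperbolicSpace.hdist x a) ^ (-β * q))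
          (fun x => Real.sinh (HyperbolicSpace.hdist x a) ^ α) ↔
        α ≤ 0 ∧ ((n : ℝ) - 1) / q ≤ α + β ∧
          (α = 0 → β ≠ ((n : ℝ) - 1) / q ∧ β ≠ (n : ℝ) / q))) ∧
    ((n : ℝ) - β * q < 0 →
      (HyperbolicSpace.L1HardyInequality a q
          (fun x => Real.sinh (HyperbolicSpace.hdist x a) ^ (-β * q))
          (fun x => Real.sinh (HyperbolicSpace.hdist x a) ^ α) ↔
        α ≤ 0 ∧ ((n : ℝ) - 1) / q ≤ α + β ∧ α + β ≤ (n : ℝ) / q)) := by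
  have hq0 : 0 < q := by linarith
  rw [HyperbolicSpace.l1HardyInequality_sinh_rpow_iff hn a α β hq]
  refine ⟨fun hk => ?_, fun hk => ?_⟩
  · simp only [not_lt.2 hk, false_imp_iff, true_and]
  · refine ⟨fun h => ⟨h.1, h.2.1, h.2.2.1 hk⟩, fun h => ⟨h.1, h.2.1, fun _ => h.2.2, ?_⟩⟩
    -- For `α = 0` the upper bound reads `βq ≤ n`, against `n - βq < 0`; the exceptional points do
    -- not occur here.
    rintro rfl
    have h3 := h.2.2
    rw [le_div_iff₀ hq0] at h3
    linarith
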